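/- Let $p$ be a prime and $\omega_p=e^{2\pi i/p}$. A $p$-ary box is a no-signalling conditional probability distribution $P(a,b\mid x,y)$ with inputs $x,y$ and outputs $a,b$ in $\mathbb{Z}_p$ ($x,a$ on Alice's side, $y,b$ on Bob's side; neither party's marginal depends on the other's input). For $j\in\mathbb{Z}_p$ put $$\mu_j=\frac1{p^2}\sum_{x,y\in\mathbb{Z}_p}P(a-b=xy-j\mid x,y)=\frac1{p^2}\sum_{x,y,k\in\mathbb{Z}_p}P(k,\,k-xy+j\mid x,y).$$ For $0\le x\le 1$ let $h_p(x)=h(x)+(1-x)\log(p-1)$, where $h(x)=-x\log x-(1-x)\log(1-x)$ is the binary entropy function. The function $h_p$ maps $[1/p,1]$ decreasingly onto $[0,\log p]$; let $h_p^{-1}:[0,\log p]\to[1/p,1]$ be the inverse of this restriction. A world is a class of (finite-alphabet, bipartite) no-signalling boxes. Information causality holds in it if the following is true for all integers $N,m\ge 0$. Alice receives independent uniformly random $x_0,\dots,x_{N-1}\in\mathbb{Z}_p$ and Bob receives an index $y\in\{0,\dots,N-1\}$; they may use shared (and local) randomness and, each by adaptive local operations, any finite number of copies of boxes of the world; Alice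 sends $m$ elements of $\mathbb{Z}_p$ to Bob, who then outputs a guess $b\in\mathbb{Z}_p$ of $x_y$. Then for every such protocol $$\sum_{i=0}^{N-1}I(x_i:b\mid y=i)\le m\log p,$$ where $I(x_i:b\mid y=i)$ is the Shannon mutual information of $x_i$ and $b$ when Bob's index is $i$. Theorem. In any world in which information causality holds, every $p$-ary box $P$ satisfies, for all $n\ge1$, $N=p^n$ and $c\in\mathbb{Z}_p$, $$\frac1p\sum_{k=0}^{p-1}\omega_p^{ck}\Bigl(\sum_{j=0}^{p-1}\mu_j\,\omega_p^{jk}\Bigr)^{n(p-1)}\le h_p^{-1}\Bigl(\frac{N-1}{N}\log p\Bigr)$$ (in particular, the left-hand side is a real number). -/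

import Mathlib

open scoped BigOperators

namespace InfoCausality

noncomputable section

/-- A no-signalling bipartite correlation box: Alice inputs `x : X` and receives `a : A`, Bob inputs
`y : Y` and receives `b : B`, and `prob a b x y` is the conditional probability `P(a, b | x, y)`. -/
structure Box (X Y A B : Type) [Fintype A] [Fintype B] where
  prob : A → B → X → Y → ℝ
  prob_nonneg : ∀ a b x y, 0 ≤ prob a b x y
  prob_sum : ∀ x y, ∑ a, ∑ b, prob a b x y = 1
  /-- Alice's marginal does not depend on Bob's input. -/
  noSignalling_alice : ∀ a x y y', ∑ b, prob a b x y = ∑ b, prob a b x y'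
  /-- Bob's marginal does not depend on Alice's input. -/
  noSignalling_bob : ∀ b x x' y, ∑ a, prob a b x y = ∑ a, prob a b x' y

/-- A no-signalling box together with its finite input and output alphabets. -/
structure Resource where
  X : Type
  Y : Type
  A : Type
  B : Type
  [fintypeX : Fintype X]
  [fintypeY : Fintype Y]
  [fintypeA : Fintype A]
  [fintypeB : Fintype B]
  box : Box X Y A B

attribute [instance] Resource.fintypeX Resource.fintypeY Resource.fintypeA Resource.fintypeB

/-- A world, described by the no-signalling boxes that exist in it. Spatially separated parties may
share any finite number of copies of each of them, besides shared randomness. -/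
abbrev World := Set Resource

/-- A `p`-nary-input, `p`-nary-output no-signalling box. -/
abbrev PBox (p : ℕ) [NeZero p] := Box (ZMod p) (ZMod p) (ZMod p) (ZMod p)

/-- A `p`-nary box, regarded as a resource. -/
def PBox.toResource {p : ℕ} [NeZero p] (P : PBox p) : Resource where
  X := ZMod p
  Y := ZMod p
  A := ZMod p
  B := ZMod p
  box := P

/-- A deterministic adaptive way for one party to use her (or his) ends of the boxes in `S`, each
exactly once: the party chooses a box `i` and an input for it, receives an output, and then continues
with the remaining boxes in a way that may depend on this output. (As the boxes are no-signalling,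
leaving a box unused amounts to giving it an arbitrary input and ignoring its output.) Here `X i` and
`A i` are the party's input and output alphabets of box `i`. -/
inductive Wiring {ι : Type} [DecidableEq ι] (X A : ι → Type) : Finset ι → Type
  | done : Wiring X A ∅
  | query {S : Finset ι} (i : ι) (hi : i ∈ S) (x : X i) (next : A i → Wiring X A (S.erase i)) :
      Wiring X A S

/-- The input that box `j` is given when the outputs of the boxes are `a`. -/
def Wiring.input {ι : Type} [DecidableEq ι] {X A : ι → Type} :
    {S : Finset ι} → Wiring X A S → (∀ i, A i) → (j : ι) → j ∈ S → X j
  | _, .done, _, j, hj => absurd hj (Finset.notMem_empty j)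
  | _, .query i _ x next, a, j, hj =>
      if h : j = i then h ▸ x
      else (next (a i)).input a j (Finset.mem_erase.2 ⟨h, hj⟩)

/-- A protocol, in the world `W`, for the task in which Alice holds `N` digits in `ZMod p`, Bob holds
an index in `Fin N`, Alice sends `m` digits in `ZMod p` to Bob, and Bob then outputs a digit.
The parties share a random variable with values in a finite set `Ω` (which may also contain the local
randomness of each of them) and finitely many boxes of `W`. -/
structure Protocol (W : World) (p N m : ℕ) where
  Ω : Type
  [fintypeΩ : Fintype Ω]
  weight : Ω → ℝ
  weight_nonneg : ∀ ω, 0 ≤ weight ω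
  weight_sum : ∑ ω, weight ω = 1
  /-- the number of shared boxes -/
  M : ℕ
  box : Fin M → Resource
  box_mem : ∀ i, box i ∈ W
  /-- how Alice uses her ends of the boxes, given the shared randomness and her digits -/
  alice : Ω → (Fin N → ZMod p) →
    Wiring (fun i => (box i).X) (fun i => (box i).A) Finset.univ
  /-- Alice's message, given the shared randomness, her digits and the outputs she obtained -/
  message : Ω → (Fin N → ZMod p) → (∀ i, (box i).A) → (Fin m → ZMod p)
  /-- how Bob uses his ends of the boxes, given the shared randomness, his index and the message -/
  bob : Ω → Fin N → (Fin m → ZMod p) →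
    Wiring (fun i => (box i).Y) (fun i => (box i).B) Finset.univ
  /-- Bob's guess, given the shared randomness, his index, the message and the outputs he obtained -/
  guess : Ω → Fin N → (Fin m → ZMod p) → (∀ i, (box i).B) → ZMod p

attribute [instance] Protocol.fintypeΩ

variable {W : World} {p N m : ℕ}

/-- The probability that, for shared randomness `ω`, digits `x` and index `y`, the boxes output `a`
to Alice and `b` to Bob. -/
def Protocol.outcomeProb (π : Protocol W p N m) (ω : π.Ω) (x : Fin N → ZMod p) (y : Fin N)
    (a : ∀ i, (π.box i).A) (b : ∀ i, (π.box i).B) : ℝ :=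
  ∏ i, (π.box i).box.prob (a i) (b i)
    ((π.alice ω x).input a i (Finset.mem_univ i))
    ((π.bob ω y (π.message ω x a)).input b i (Finset.mem_univ i))

/-- The probability that Bob's guess is `v` when Alice's digits are `x` and Bob's index is `y`. -/
def Protocol.guessProb (π : Protocol W p N m) (x : Fin N → ZMod p) (y : Fin N) (v : ZMod p) : ℝ :=
  ∑ ω, π.weight ω * ∑ a, ∑ b,
    if π.guess ω y (π.message ω x a) b = v then π.outcomeProb ω x y a b else 0

/-- The joint distribution of Alice's `i`-th digit and Bob's guess, conditioned on Bob's index being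
`i`, when Alice's digits are independent and uniformly random. -/
def Protocol.jointProb [NeZero p] (π : Protocol W p N m) (i : Fin N) (u v : ZMod p) : ℝ :=
  ∑ x : Fin N → ZMod p, if x i = u then ((p : ℝ) ^ N)⁻¹ * π.guessProb x i v else 0

/-- Shannon mutual information of the two components of a pair with joint distribution `q` (with
natural logarithms; the convention `0 log 0 = 0` holds because `Real.log 0 = 0`). -/
def mutualInfo {α β : Type} [Fintype α] [Fintype β] (q : α → β → ℝ) : ℝ :=
  ∑ u, ∑ v, q u v * Real.log (q u v / ((∑ v', q u v') * (∑ u', q u' v)))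

/-- The degree of success `∑ i, I(x_i : b | y = i)` of a protocol. -/
def Protocol.success [NeZero p] (π : Protocol W p N m) : ℝ :=
  ∑ i : Fin N, mutualInfo (π.jointProb i)

/-- Information causality (for `p`-nary digits) holds in the world `W`: whatever protocol is used,
by sending `m` digits Alice gives Bob a degree of success of at most `m log p`. -/
def InformationCausality (p : ℕ) [NeZero p] (W : World) : Prop :=
  ∀ (N m : ℕ) (π : Protocol W p N m), π.success ≤ m * Real.log p

/-- `μ_j = p⁻² ∑_{x,y} P(a - b = x y - j | x, y)`. -/
def mu {p : ℕ} [NeZero p] (P : PBox p) (j : ZMod p) : ℝ :=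
  1 / (p : ℝ) ^ 2 * ∑ x : ZMod p, ∑ y : ZMod p, ∑ k : ZMod p, P.prob k (k - x * y + j) x y

/-- `ω_p = exp (2 π i / p)`. -/
def rootOfUnity (p : ℕ) : ℂ := Complex.exp (2 * Real.pi * Complex.I / p)

/-- `h_p(x) = h(x) + (1 - x) log (p - 1)`, where `h` is the binary entropy function. -/
def hp (p : ℕ) (x : ℝ) : ℝ := Real.binEntropy x + (1 - x) * Real.log ((p : ℝ) - 1)

/-- The inverse of `h_p` on `[1/p, 1]`, which `h_p` maps decreasingly onto `[0, log p]`. -/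
def hpInv (p : ℕ) (t : ℝ) : ℝ := Function.invFunOn (hp p) (Set.Icc (1 / (p : ℝ)) 1) t

/-- `(1/p) ∑_k ω_p^{ck} (∑_j μ_j ω_p^{jk})^M`. -/
def chi {p : ℕ} [NeZero p] (P : PBox p) (M : ℕ) (c : ZMod p) : ℂ :=
  1 / (p : ℂ) * ∑ k : ZMod p, rootOfUnity p ^ (c.val * k.val) *
    (∑ j : ZMod p, (mu P j : ℂ) * rootOfUnity p ^ (j.val * k.val)) ^ M

end

end InfoCausality

/-! ### Entropy, the inverse of `hp`, and Fano's inequality -/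

namespace InfoCausality

/-! The left-hand side is a probability, realised by a protocol to which information causality
applies. Address the `N = p ^ n` digits by `(ZMod p)^n`. A function on `ZMod p` is a polynomial of
degree below `p`, so Bob can read a chosen one of `p` digits from its constant coefficient and `p -
1` products of Alice's coefficients with powers of his index. Each product is shared by one box as
`a - b`. Alice absorbs her shares into one digit, and nesting this `n` levels leaves one digit to
send (`encode_last_sub`). Bob uses `n * (p - 1)` of the boxes, and his guess is off by the sum of
their errors (`bobGuess_encode`).

Random shifts of all inputs make the boxes' inputs uniform (`sum_twirl`), so the errors are
independent, each equal to `-j` with probability `mu P j`. By Fourier inversion the total error is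
`c` with probability `q c`, the value of `chi` (`chi_eq_sumProb`).

Each digit then contributes `log p - H(q)` to the success, where `H` is Shannon entropy, so `m = 1`
gives `N (log p - H(q)) ≤ log p`. Fano's inequality `H(q) ≤ hp p (q c)` and the monotonicity of `hp`
conclude. -/

theorem hp_eq_qaryEntropy (p : ℕ) (x : ℝ) : hp p x = Real.qaryEntropy p (1 - x) := by
  simp only [hp, Real.qaryEntropy, Real.binEntropy_one_sub]
  push_cast
  ring

theorem hp_inv_self {p : ℕ} (hp2 : 2 ≤ p) : hp p (1 / p) = Real.log p := by
  have h2 : (2 : ℝ) ≤ p := by exact_mod_cast hp2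
  have h0 : (p : ℝ) ≠ 0 := by positivity
  have h1 : (p : ℝ) - 1 ≠ 0 := by linarith
  have e : 1 - 1 / (p : ℝ) = (p - 1) / p := by field_simp
  rw [hp, Real.binEntropy_eq_negMulLog_add_negMulLog_one_sub, Real.negMulLog, Real.negMulLog, e,
    Real.log_div h1 h0, Real.log_div one_ne_zero h0, Real.log_one]
  field_simp
  ring

theorem hp_one (p : ℕ) : hp p 1 = 0 := by simp [hp]

theorem continuous_hp (p : ℕ) : Continuous (hp p) := by
  have : hp p = fun x => Real.qaryEntropy p (1 - x) := funext (hp_eq_qaryEntropy p)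
  rw [this]
  exact Real.qaryEntropy_continuous.comp (continuous_const.sub continuous_id)

theorem hp_strictAntiOn {p : ℕ} (hp2 : 2 ≤ p) :
    StrictAntiOn (hp p) (Set.Icc (1 / (p : ℝ)) 1) := by
  intro x hx y hy hxy
  rw [hp_eq_qaryEntropy, hp_eq_qaryEntropy]
  refine Real.qaryEntropy_strictMonoOn hp2 ⟨?_, ?_⟩ ⟨?_, ?_⟩ ?_ <;>
    linarith [hx.1, hx.2, hy.1, hy.2]

theorem hpInv_spec {p : ℕ} (hp2 : 2 ≤ p) {t : ℝ} (h0 : 0 ≤ t) (h1 : t ≤ Real.log p) :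
    hpInv p t ∈ Set.Icc (1 / (p : ℝ)) 1 ∧ hp p (hpInv p t) = t := by
  have h2 : (2 : ℝ) ≤ p := by exact_mod_cast hp2
  have hle : 1 / (p : ℝ) ≤ 1 := by
    rw [div_le_one (by positivity)]
    linarith
  refine Function.invFunOn_pos ?_
  have := intermediate_value_Icc' hle (continuous_hp p).continuousOn
  rw [hp_one, hp_inv_self hp2] at this
  exact this ⟨h0, h1⟩

/-- Below `1 / p`, where `hp` is not decreasing, the bound is automatic because the chosen inverse
lies in `[1/p, 1]`. -/
theorem le_hpInv {p : ℕ} (hp2 : 2 ≤ p) {t x : ℝ} (h0 : 0 ≤ t) (h1 : t ≤ Real.log p)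
    (hx : x ≤ 1) (htx : t ≤ hp p x) : x ≤ hpInv p t := by
  obtain ⟨hmem, heq⟩ := hpInv_spec hp2 h0 h1
  rcases le_total x (1 / (p : ℝ)) with h | h
  · exact h.trans hmem.1
  · by_contra hlt
    have := hp_strictAntiOn hp2 hmem ⟨h, hx⟩ (not_le.1 hlt)
    linarith

/-- Fano's inequality for a probability vector with `p` entries. -/
theorem sum_negMulLog_le_hp {p : ℕ} [NeZero p] (hp2 : 2 ≤ p) (q : ZMod p → ℝ)
    (hq : ∀ c, 0 ≤ q c) (hq1 : ∑ c, q c = 1) (c : ZMod p) :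
    ∑ d, Real.negMulLog (q d) ≤ hp p (q c) := by
  have h2 : (2 : ℝ) ≤ p := by exact_mod_cast hp2
  have hpos : (0 : ℝ) < p - 1 := by linarith
  have hcard : ((Finset.univ.erase c).card : ℝ) = p - 1 := by
    rw [Finset.card_erase_of_mem (Finset.mem_univ c), Finset.card_univ, ZMod.card,
      Nat.cast_sub (by omega), Nat.cast_one]
  have hsum : ∑ d ∈ Finset.univ.erase c, q d = 1 - q c := by
    rw [← hq1, ← Finset.add_sum_erase _ _ (Finset.mem_univ c)]
    ring
  -- Jensen's inequality with uniform weights on the `p - 1` values other than `c`.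
  have J := Real.concaveOn_negMulLog.le_map_sum (t := Finset.univ.erase c)
    (w := fun _ => ((p : ℝ) - 1)⁻¹) (p := q) (fun _ _ => (inv_pos.2 hpos).le)
    (by rw [Finset.sum_const, nsmul_eq_mul, hcard, mul_inv_cancel₀ hpos.ne'])
    (fun d _ => hq d)
  simp only [smul_eq_mul] at J
  rw [← Finset.mul_sum, ← Finset.mul_sum, hsum, inv_mul_le_iff₀ hpos] at J
  rw [← Finset.add_sum_erase _ _ (Finset.mem_univ c), hp,
    Real.binEntropy_eq_negMulLog_add_negMulLog_one_sub, add_assoc]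
  refine add_le_add le_rfl (J.trans_eq ?_)
  rcases eq_or_ne (1 - q c) 0 with h | h
  · simp [h]
  · rw [Real.negMulLog, Real.negMulLog, Real.log_mul (inv_ne_zero hpos.ne') h, Real.log_inv]
    field_simp
    ring

end InfoCausality

namespace InfoCausality

noncomputable section

/-! ### Wirings -/

/-- Queries in the order of a rank function realise every input function that is causal for it. -/
theorem Wiring.exists_input_eq {ι : Type} [DecidableEq ι] {X A : ι → Type}
    (rank : ι → ℕ) (F : (j : ι) → (∀ i, A i) → X j)
    (hF : ∀ j a a', (∀ i, rank i < rank j → a i = a' i) → F j a = F j a') (S : Finset ι)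
    (a₀ : ∀ i, A i) :
    ∃ w : Wiring X A S, ∀ a, (∀ j, j ∉ S → a j = a₀ j) → ∀ j hj, w.input a j hj = F j a := by
  induction hS : S.card generalizing S a₀ with
  | zero =>
    obtain rfl := Finset.card_eq_zero.1 hS
    exact ⟨.done, fun a _ j hj => absurd hj (Finset.notMem_empty j)⟩
  | succ k ih =>
    -- A box of least rank can be queried first: its input depends only on outputs of boxes outside
    -- `S`, which are already recorded in `a₀`.
    obtain ⟨i, hi, hmin⟩ := Finset.exists_min_image S rank (Finset.card_pos.1 (by omega))
    have hcard : (S.erase i).card = k := by rw [Finset.card_erase_of_mem hi, hS]; rfl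
    choose next hnext using fun b : A i => ih (S.erase i) (Function.update a₀ i b) hcard
    refine ⟨.query i hi (F i a₀) next, fun a ha j hj => ?_⟩
    by_cases h : j = i
    · subst h
      simp only [Wiring.input, dite_true]
      refine hF _ _ _ fun l hl => (ha l fun hlS => ?_).symm
      exact absurd (hmin l hlS) (not_le.2 hl)
    · simp only [Wiring.input, h, dite_false]
      refine hnext (a i) a (fun l hl => ?_) j _
      by_cases hli : l = i
      · subst hli
        simp
      · rw [Function.update_of_ne hli]
        exact ha l fun hlS => hl (Finset.mem_erase.2 ⟨hli, hlS⟩)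

/-! ### Characters -/

variable {p : ℕ} [NeZero p]

theorem rootOfUnity_pow_val_mul_val (c k : ZMod p) :
    rootOfUnity p ^ (c.val * k.val) = ZMod.stdAddChar (c * k) := by
  have : c * k = (((c.val * k.val : ℕ) : ℤ) : ZMod p) := by simp
  rw [this, ZMod.stdAddChar_coe, rootOfUnity, ← Complex.exp_nat_mul]
  congr 1
  push_cast
  ring

theorem map_sum_stdAddChar {ι : Type} (J : Finset ι) (f : ι → ZMod p) :
    (ZMod.stdAddChar (∑ j ∈ J, f j) : ℂ) = ∏ j ∈ J, ZMod.stdAddChar (f j) := by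
  classical
  induction J using Finset.induction_on with
  | empty => simp
  | insert j J hj ih => rw [Finset.sum_insert hj, Finset.prod_insert hj, AddChar.map_add_eq_mul, ih]

theorem indicator_eq_sum_stdAddChar (s c : ZMod p) :
    (if s = c then 1 else 0 : ℂ) =
      1 / (p : ℂ) * ∑ k : ZMod p, ZMod.stdAddChar (c * k) * ZMod.stdAddChar (-s * k) := by
  have h : ∀ k : ZMod p, ZMod.stdAddChar (c * k) * ZMod.stdAddChar (-s * k) =
      (ZMod.stdAddChar (k * (c - s)) : ℂ) := fun k => by
    rw [← AddChar.map_add_eq_mul]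
    congr 1
    ring
  have hp0 : (p : ℂ) ≠ 0 := Nat.cast_ne_zero.2 (NeZero.ne p)
  rw [Finset.sum_congr rfl fun k _ => h k, AddChar.sum_mulShift _ (ZMod.isPrimitive_stdAddChar p),
    ZMod.card]
  by_cases hs : s = c
  · simp [hs, hp0]
  · simp [hs, sub_eq_zero, Ne.symm hs]

/-! ### Sums of independent errors -/

/-- The probability that `∑ j ∈ J, e (t j) = c` for independent `t j` with distribution `g`. -/
def sumProb {ι T : Type} [Fintype ι] [DecidableEq ι] [Fintype T] (g : T → ℝ) (e : T → ZMod p)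
    (J : Finset ι) (c : ZMod p) : ℝ :=
  ∑ t : ι → T, if ∑ j ∈ J, e (t j) = c then ∏ j, g (t j) else 0

section sumProb

variable {ι T : Type} [Fintype ι] [DecidableEq ι] [Fintype T] (g : T → ℝ) (e : T → ZMod p)
  (J : Finset ι)

omit [NeZero p] in
theorem sumProb_nonneg (hg : ∀ t, 0 ≤ g t) (c : ZMod p) : 0 ≤ sumProb g e J c :=
  Finset.sum_nonneg fun t _ => by
    split_ifs
    · exact Finset.prod_nonneg fun j _ => hg _
    · exact le_rfl

theorem sum_sumProb (hg : ∑ t, g t = 1) : ∑ c, sumProb g e J c = 1 := by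
  simp only [sumProb]
  rw [Finset.sum_comm]
  simp only [Finset.sum_ite_eq, Finset.mem_univ, if_true]
  rw [← Fintype.prod_sum (fun _ t => g t)]
  simp [hg]

theorem ofReal_sumProb (hg : ∑ t, g t = 1) (c : ZMod p) :
    (sumProb g e J c : ℂ) = 1 / (p : ℂ) * ∑ k : ZMod p, ZMod.stdAddChar (c * k) *
      (∑ t, (g t : ℂ) * ZMod.stdAddChar (-e t * k)) ^ J.card := by
  have key : ∀ k : ZMod p, (∑ t, (g t : ℂ) * ZMod.stdAddChar (-e t * k)) ^ J.card =
      ∑ t : ι → T, (∏ j, (g (t j) : ℂ)) * ZMod.stdAddChar (-(∑ j ∈ J, e (t j)) * k) := by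
    intro k
    -- Indices outside `J` contribute total mass `1`, so the power over `J` becomes a product over
    -- all of `ι`.
    have h1 : ∀ j : ι, ∑ t, (g t : ℂ) * (if j ∈ J then ZMod.stdAddChar (-e t * k) else 1) =
        if j ∈ J then ∑ t, (g t : ℂ) * ZMod.stdAddChar (-e t * k) else 1 := fun j => by
      split_ifs
      · rfl
      · simp only [mul_one]
        exact_mod_cast hg
    rw [← Finset.prod_const, ← Finset.prod_ite_mem_eq]
    rw [← Finset.prod_congr rfl fun j _ => h1 j,
      Fintype.prod_sum (fun j t => (g t : ℂ) * (if j ∈ J then ZMod.stdAddChar (-e t * k) else 1))]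
    refine Finset.sum_congr rfl fun t _ => ?_
    rw [Finset.prod_mul_distrib, Finset.prod_ite_mem_eq]
    congr 1
    rw [← Finset.sum_neg_distrib, Finset.sum_mul]
    exact (map_sum_stdAddChar _ _).symm
  simp only [key, sumProb, Finset.mul_sum]
  push_cast
  rw [Finset.sum_comm]
  refine Finset.sum_congr rfl fun t _ => ?_
  have := indicator_eq_sum_stdAddChar (∑ j ∈ J, e (t j)) c
  have h : ((if ∑ j ∈ J, e (t j) = c then ∏ j, g (t j) else 0 : ℝ) : ℂ) =
      (∏ j, (g (t j) : ℂ)) * (if ∑ j ∈ J, e (t j) = c then 1 else 0) := by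
    split_ifs <;> simp
  rw [h, this, Finset.mul_sum, Finset.mul_sum]
  exact Finset.sum_congr rfl fun k _ => by ring

end sumProb

/-- Inputs and outputs `(x, y, a, b)` of a box. -/
abbrev Run (p : ℕ) : Type := (ZMod p × ZMod p) × ZMod p × ZMod p

/-- The distribution of the inputs and outputs of `P` for uniformly random inputs. -/
def PBox.runProb (P : PBox p) (t : Run p) : ℝ :=
  1 / (p : ℝ) ^ 2 * P.prob t.2.1 t.2.2 t.1.1 t.1.2

/-- The deviation of `a - b` from the product of the inputs. -/
def Run.error (t : Run p) : ZMod p := t.2.1 - t.2.2 - t.1.1 * t.1.2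

theorem PBox.runProb_nonneg (P : PBox p) (t : Run p) : 0 ≤ P.runProb t :=
  mul_nonneg (by positivity) (P.prob_nonneg _ _ _ _)

theorem PBox.sum_runProb (P : PBox p) : ∑ t, P.runProb t = 1 := by
  have hp0 : (p : ℝ) ≠ 0 := Nat.cast_ne_zero.2 (NeZero.ne p)
  simp only [PBox.runProb, ← Finset.mul_sum, Fintype.sum_prod_type, P.prob_sum]
  simp [ZMod.card]
  field_simp

/-- The sign reflects the convention `a - b = x y - j` in `mu`: the error is `-j` with probability
`mu P j`. -/
theorem PBox.sum_runProb_mul (P : PBox p) (f : ZMod p → ℂ) :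
    ∑ t, (P.runProb t : ℂ) * f (-Run.error t) = ∑ j, (mu P j : ℂ) * f j := by
  simp only [PBox.runProb, Run.error, Fintype.sum_prod_type, mu]
  push_cast
  simp only [Finset.mul_sum, Finset.sum_mul]
  have comm : ∀ (G : ZMod p → ZMod p → ZMod p → ZMod p → ℂ),
      ∑ j, ∑ x, ∑ y, ∑ k, G j x y k = ∑ x, ∑ y, ∑ k, ∑ j, G j x y k := fun G => by
    rw [Finset.sum_comm]
    refine Finset.sum_congr rfl fun x _ => ?_
    rw [Finset.sum_comm]
    refine Finset.sum_congr rfl fun y _ => ?_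
    rw [Finset.sum_comm]
  refine Eq.trans ?_ (comm _).symm
  refine Finset.sum_congr rfl fun x _ => Finset.sum_congr rfl fun y _ =>
    Finset.sum_congr rfl fun k _ => ?_
  refine (Fintype.sum_equiv (Equiv.addLeft (k - x * y)) _ _ fun j => ?_).symm
  simp only [Equiv.coe_addLeft]
  rw [show -(k - (k - x * y + j) - x * y) = j by ring]

theorem chi_eq_sumProb (P : PBox p) {ι : Type} [Fintype ι] [DecidableEq ι] (J : Finset ι)
    (c : ZMod p) : chi P J.card c = sumProb P.runProb Run.error J c := by
  rw [ofReal_sumProb _ _ _ P.sum_runProb, chi]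
  simp only [rootOfUnity_pow_val_mul_val]
  congr 1
  refine Finset.sum_congr rfl fun k _ => ?_
  rw [← P.sum_runProb_mul fun j => ZMod.stdAddChar (j * k)]

/-! ### Mutual information of a digit and its noisy copy -/

/-- The copy is `v = u + noise` with `u` uniform, so both marginals are uniform and only the entropy
of the noise is lost. -/
theorem mutualInfo_noisy_copy (q : ZMod p → ℝ) (hq : ∑ c, q c = 1) :
    mutualInfo (fun u v : ZMod p => (p : ℝ)⁻¹ * q (v - u)) =
      Real.log p - ∑ c, Real.negMulLog (q c) := by
  have hp0 : (p : ℝ) ≠ 0 := Nat.cast_ne_zero.2 (NeZero.ne p)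
  have h1 : ∀ u : ZMod p, ∑ v, q (v - u) = 1 := fun u => by
    rw [← hq]; exact Fintype.sum_equiv (Equiv.subRight u) _ _ fun _ => rfl
  have h2 : ∀ v : ZMod p, ∑ u, q (v - u) = 1 := fun v => by
    rw [← hq]; exact Fintype.sum_equiv (Equiv.subLeft v) _ _ fun _ => rfl
  have h3 : ∀ c, q c * Real.log (p * q c) = q c * Real.log p - Real.negMulLog (q c) := fun c => by
    rcases eq_or_ne (q c) 0 with h | h
    · simp [h]
    · rw [Real.log_mul hp0 h, Real.negMulLog]
      ring
  have h4 : ∀ u : ZMod p, ∑ v, q (v - u) * Real.log (p * q (v - u)) =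
      Real.log p - ∑ c, Real.negMulLog (q c) := fun u => by
    rw [Fintype.sum_equiv (Equiv.subRight u) (fun v => q (v - u) * Real.log (p * q (v - u)))
        (fun c => q c * Real.log (p * q c)) fun _ => rfl,
      Finset.sum_congr rfl fun c _ => h3 c, Finset.sum_sub_distrib, ← Finset.sum_mul, hq, one_mul]
  have h5 : ∀ x : ℝ, (p : ℝ)⁻¹ * x / ((p : ℝ)⁻¹ * (1 * ((p : ℝ)⁻¹ * 1))) = p * x := fun x => by
    field_simp
  simp only [mutualInfo, ← Finset.mul_sum, h1, h2, h5, mul_assoc, h4]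
  rw [Finset.sum_const, Finset.card_univ, ZMod.card, nsmul_eq_mul]
  field_simp

/-! ### Marginals of uniform digits -/

theorem sum_ite_apply_eq {N : ℕ} (i : Fin N) (u : ZMod p) (C : ℝ) :
    ∑ x : Fin N → ZMod p, (if x i = u then ((p : ℝ) ^ N)⁻¹ * C else 0) = (p : ℝ)⁻¹ * C := by
  have hp0 : (p : ℝ) ≠ 0 := Nat.cast_ne_zero.2 (NeZero.ne p)
  have key : ∑ x : Fin N → ZMod p, (if x i = u then (1 : ℝ) else 0) = (p : ℝ) ^ (N - 1) := by
    -- As a product over coordinates, the indicator lets the sum over `x` factor.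
    have h : ∀ x : Fin N → ZMod p, (if x i = u then (1 : ℝ) else 0) =
        ∏ j, if j = i then (if x j = u then (1 : ℝ) else 0) else 1 := fun x => by
      simp [Finset.prod_ite_eq']
    rw [Finset.sum_congr rfl fun x _ => h x,
      ← Fintype.prod_sum (fun j t => if j = i then (if t = u then (1 : ℝ) else 0) else 1),
      ← Finset.mul_prod_erase _ _ (Finset.mem_univ i),
      Finset.prod_congr rfl (g := fun _ => (p : ℝ)) fun j hj => by
        simp [Finset.ne_of_mem_erase hj, ZMod.card]]
    simp
  have hN : N = (N - 1) + 1 := by have := i.pos; omega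
  have hpow : (p : ℝ) ^ N = p ^ (N - 1) * p := by
    conv_lhs => rw [hN]
    rw [pow_succ]
  have h' : ∀ x : Fin N → ZMod p, (if x i = u then ((p : ℝ) ^ N)⁻¹ * C else 0) =
      (if x i = u then 1 else 0) * (((p : ℝ) ^ N)⁻¹ * C) := fun x => by split_ifs <;> simp
  rw [Finset.sum_congr rfl fun x _ => h' x, ← Finset.sum_mul, key, hpow]
  field_simp

end

end InfoCausality

namespace InfoCausality

noncomputable section

/-! ### Randomising the inputs of the boxes -/

/-- Uniformly random shifts make the inputs of all boxes uniform and independent of everything else,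
even if Alice's inputs before the shift depend on what happened at boxes of lower rank. -/
theorem sum_twirl {p : ℕ} [NeZero p] {ι : Type} [Fintype ι] [DecidableEq ι] (rank : ι → ℕ)
    (U : (ι → ZMod p) → (ι → ZMod p) → (ι → ZMod p) → ι → ZMod p)
    (hU : ∀ r r' s a j, (∀ i, rank i < rank j → r i = r' i) → U r s a j = U r' s a j)
    (w : ι → ZMod p) (H : (ι → Run p) → ℝ) :
    ∑ r, ∑ s, ∑ a, ∑ b : ι → ZMod p, H (fun j => ((r j + U r s a j, w j + s j), a j, b j)) = ∑ t, H t := by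
  -- The shift map is triangular for the rank: `r j` is recovered once the shifts of lower rank are
  -- known.
  have hbij : ∀ s a, Function.Bijective fun (r : ι → ZMod p) j => r j + U r s a j := by
    intro s a
    refine Finite.injective_iff_bijective.1 fun r r' h => ?_
    have key : ∀ k j, rank j < k → r j = r' j := by
      intro k
      induction k with
      | zero => exact fun j hj => absurd hj (Nat.not_lt_zero _)
      | succ k ih =>
        intro j hj
        have hj' : r j + U r s a j = r' j + U r' s a j := congrFun h j
        rw [hU r r' s a j fun i hi => ih i (by omega)] at hj'
        exact add_right_cancel hj'
    exact funext fun j => key _ j (Nat.lt_succ_self _)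
  let E : (ι → Run p) ≃ ((ι → ZMod p) × (ι → ZMod p)) × (ι → ZMod p) × (ι → ZMod p) :=
    (Equiv.arrowProdEquivProdArrow ι _ _).trans
      ((Equiv.arrowProdEquivProdArrow ι _ _).prodCongr (Equiv.arrowProdEquivProdArrow ι _ _))
  rw [← E.symm.sum_comp H]
  simp only [Fintype.sum_prod_type]
  rw [Finset.sum_comm]
  rw [Finset.sum_comm (s := Finset.univ (α := ι → ZMod p)) (t := Finset.univ (α := ι → ZMod p))
    (f := fun x y => ∑ a, ∑ b, H (E.symm ((x, y), a, b)))]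
  refine Fintype.sum_equiv (Equiv.addLeft w) _ _ fun s => ?_
  rw [Finset.sum_comm]
  conv_rhs => rw [Finset.sum_comm]
  refine Finset.sum_congr rfl fun a _ => ?_
  exact Fintype.sum_bijective _ (hbij s a) _ _ fun r => rfl

/-! ### Interpolation -/

variable {p : ℕ} [Fact p.Prime]

/-- The coefficients of the polynomial of degree less than `p` that represents `f`. -/
def interpCoeff (f : ZMod p → ZMod p) (i : ℕ) : ZMod p :=
  (Lagrange.interpolate Finset.univ id f).coeff i

theorem eq_interpCoeff_add_sum (f : ZMod p → ZMod p) (t : ZMod p) :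
    f t = interpCoeff f 0 + ∑ i : Fin (p - 1), interpCoeff f (i + 1) * t ^ (i.1 + 1) := by
  have hpos : 0 < p := (Fact.out : p.Prime).pos
  have hdeg := Lagrange.degree_interpolate_lt (s := Finset.univ) (v := id) f
    (Function.injective_id.injOn)
  rw [Finset.card_univ, ZMod.card] at hdeg
  have hev := Lagrange.eval_interpolate_at_node (s := Finset.univ) (v := id) f
    (Function.injective_id.injOn) (Finset.mem_univ t)
  rw [id, Polynomial.eval_eq_sum_range' (n := p - 1 + 1)] at hev
  · rw [← hev, Finset.sum_range_succ', add_comm, pow_zero, mul_one, Finset.sum_range]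
    rfl
  · rw [Nat.sub_add_cancel hpos]
    by_cases h0 : Lagrange.interpolate Finset.univ id f = 0
    · rw [h0]; simpa using hpos
    · exact (Polynomial.natDegree_lt_iff_degree_lt h0).2 hdeg

/-! ### Nested encoding -/

/-- Boxes are labelled by a level, an address and the number of a monomial. -/
abbrev BoxIndex (p n : ℕ) : Type := Fin n × (Fin n → ZMod p) × Fin (p - 1)

/-- The address `z` with its first `k` coordinates erased. -/
def tail {n : ℕ} (k : ℕ) (z : Fin n → ZMod p) : Fin n → ZMod p :=
  fun j => if j.1 < k then 0 else z j

theorem tail_tail {n : ℕ} (k : ℕ) (z : Fin n → ZMod p) : tail k (tail k z) = tail k z := by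
  funext j
  simp only [tail]
  split_ifs <;> rfl

theorem tail_zero {n : ℕ} (z : Fin n → ZMod p) : tail 0 z = z := by
  funext j
  simp [tail]

theorem tail_self {n : ℕ} (z : Fin n → ZMod p) : tail n z = 0 := by
  funext j
  simp [tail]

theorem update_tail_succ {n : ℕ} (k : Fin n) (z : Fin n → ZMod p) :
    Function.update (tail (k + 1) z) k (z k) = tail k z := by
  funext j
  by_cases h : j = k
  · subst h
    simp [tail]
  · have h' : j.1 ≠ k.1 := fun hh => h (Fin.ext hh)
    rw [Function.update_of_ne h]
    simp only [tail]
    congr 1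
    exact propext ⟨fun _ => by omega, fun _ => by omega⟩

/-- The digit that replaces, after `k` levels of the protocol, the digits whose addresses agree with
`z` except in their first `k` coordinates; `r` and `s` are the shifts of Alice's and Bob's inputs and
`a` are Alice's outputs. -/
def encode {n : ℕ} (x : (Fin n → ZMod p) → ZMod p) (r s a : BoxIndex p n → ZMod p) :
    ℕ → (Fin n → ZMod p) → ZMod p
  | 0, z => x z
  | k + 1, z =>
    if h : k < n then
      interpCoeff (fun t => encode x r s a k (Function.update (tail (k + 1) z) ⟨k, h⟩ t)) 0 +
        ∑ i : Fin (p - 1), (a (⟨k, h⟩, tail (k + 1) z, i) -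
          (r (⟨k, h⟩, tail (k + 1) z, i) + interpCoeff (fun t =>
            encode x r s a k (Function.update (tail (k + 1) z) ⟨k, h⟩ t)) (i + 1)) *
          s (⟨k, h⟩, tail (k + 1) z, i))
    else 0

/-- Alice's inputs before the shift. -/
def bareInput {n : ℕ} (x : (Fin n → ZMod p) → ZMod p) (r s a : BoxIndex p n → ZMod p)
    (j : BoxIndex p n) : ZMod p :=
  interpCoeff (fun t => encode x r s a j.1 (Function.update j.2.1 j.1 t)) (j.2.2 + 1)

section encode

variable {n : ℕ} (x : (Fin n → ZMod p) → ZMod p)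

theorem encode_congr {r r' s s' a a' : BoxIndex p n → ZMod p} (k : ℕ)
    (h : ∀ j : BoxIndex p n, j.1.1 < k → r j = r' j ∧ s j = s' j ∧ a j = a' j) :
    encode x r s a k = encode x r' s' a' k := by
  induction k with
  | zero => rfl
  | succ k ih =>
    funext z
    rw [encode, encode, ih fun j hj => h j (by omega)]
    split_ifs with hk
    · congr 1
      refine Finset.sum_congr rfl fun i _ => ?_
      obtain ⟨h1, h2, h3⟩ := h (⟨k, hk⟩, tail (k + 1) z, i) (Nat.lt_succ_self k)
      rw [h1, h2, h3]
    · rfl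

theorem bareInput_congr {r r' s s' a a' : BoxIndex p n → ZMod p} (l : BoxIndex p n)
    (h : ∀ j : BoxIndex p n, j.1 < l.1 → r j = r' j ∧ s j = s' j ∧ a j = a' j) :
    bareInput x r s a l = bareInput x r' s' a' l := by
  rw [bareInput, bareInput, encode_congr x l.1.1 h]

variable (r s a : BoxIndex p n → ZMod p)

theorem encode_tail (k : ℕ) (z : Fin n → ZMod p) :
    encode x r s a k (tail k z) = encode x r s a k z := by
  cases k with
  | zero => rw [tail_zero]
  | succ k => rw [encode, encode, tail_tail]

/-- Interpolation at `z k` returns the level-`k` digit, so the constant coefficients cancel and only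
the box terms remain. -/
theorem encode_succ_sub (k : Fin n) (z : Fin n → ZMod p) :
    encode x r s a (k + 1) z - encode x r s a k z =
      ∑ i : Fin (p - 1), (a (k, tail (k + 1) z, i) -
        (r (k, tail (k + 1) z, i) + bareInput x r s a (k, tail (k + 1) z, i)) *
          s (k, tail (k + 1) z, i) -
        bareInput x r s a (k, tail (k + 1) z, i) * z k ^ (i.1 + 1)) := by
  have h := eq_interpCoeff_add_sum
    (fun t => encode x r s a k (Function.update (tail (k + 1) z) k t)) (z k)
  simp only [update_tail_succ, encode_tail] at h
  rw [h, encode, dif_pos k.2]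
  simp only [Fin.eta, bareInput, Finset.sum_sub_distrib]
  abel

/-- The level differences telescope. After `n` levels no coordinate of the address is left, so the
same digit serves every index. -/
theorem encode_last_sub (z : Fin n → ZMod p) :
    encode x r s a n 0 - x z =
      ∑ k : Fin n, ∑ i : Fin (p - 1), (a (k, tail (k + 1) z, i) -
        (r (k, tail (k + 1) z, i) + bareInput x r s a (k, tail (k + 1) z, i)) *
          s (k, tail (k + 1) z, i) -
        bareInput x r s a (k, tail (k + 1) z, i) * z k ^ (i.1 + 1)) := by
  have h0 : encode x r s a n 0 = encode x r s a n z := by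
    rw [← encode_tail x r s a n z, tail_self]
  rw [← Finset.sum_congr rfl fun k _ => encode_succ_sub x r s a k z,
    Fin.sum_univ_eq_sum_range (fun k => encode x r s a (k + 1) z - encode x r s a k z) n,
    Finset.sum_range_sub (fun k => encode x r s a k z), h0, encode]

end encode

/-- The boxes that Bob needs for the address `z`. -/
def path {n : ℕ} (z : Fin n → ZMod p) : Finset (BoxIndex p n) :=
  Finset.univ.map ⟨fun l : Fin n × Fin (p - 1) => (l.1, tail (l.1 + 1) z, l.2), fun l l' h => by
    simp only [Prod.mk.injEq] at h
    exact Prod.ext h.1 h.2.2⟩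

theorem card_path {n : ℕ} (z : Fin n → ZMod p) : (path z).card = n * (p - 1) := by
  simp [path]

theorem sum_path {n : ℕ} (z : Fin n → ZMod p) (f : BoxIndex p n → ZMod p) :
    ∑ j ∈ path z, f j = ∑ k : Fin n, ∑ i : Fin (p - 1), f (k, tail (k + 1) z, i) := by
  rw [path, Finset.sum_map, Fintype.sum_prod_type]
  rfl

/-- Bob's inputs before the shift. -/
def bobPower {n : ℕ} (z : Fin n → ZMod p) (j : BoxIndex p n) : ZMod p := z j.1 ^ (j.2.2.1 + 1)

/-- Bob's guess from the shifts of Alice's inputs, the message and his outputs. -/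
def bobGuess {n : ℕ} (z : Fin n → ZMod p) (r : BoxIndex p n → ZMod p) (μ : ZMod p)
    (b : BoxIndex p n → ZMod p) : ZMod p :=
  μ - ∑ j ∈ path z, (b j + r j * bobPower z j)

/-- With bare inputs `u`, `w`, one has `(r + u)(w + s) = u w + (r + u) s + r w`. Alice's encoding
removes `(r + u) s`, Bob removes `r w`, and `u w` is the monomial needed. -/
theorem bobGuess_encode {n : ℕ} (x : (Fin n → ZMod p) → ZMod p)
    (r s a b : BoxIndex p n → ZMod p) (z : Fin n → ZMod p) :
    bobGuess z r (encode x r s a n 0) b =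
      x z + ∑ j ∈ path z, Run.error
        ((r j + bareInput x r s a j, bobPower z j + s j), a j, b j) := by
  rw [bobGuess, ← sub_eq_iff_eq_add', sub_right_comm, encode_last_sub, sub_eq_iff_eq_add, sum_path, sum_path,
    ← Finset.sum_add_distrib]
  refine Finset.sum_congr rfl fun k _ => ?_
  rw [← Finset.sum_add_distrib]
  refine Finset.sum_congr rfl fun i _ => ?_
  simp only [Run.error, bobPower]
  ring

/-! ### The nested random access code -/

section protocol

variable {W : World} {P : PBox p} {n N : ℕ}

/-- A numbering of the boxes. -/
def boxEquiv (p n : ℕ) [Fact p.Prime] : BoxIndex p n ≃ Fin (Fintype.card (BoxIndex p n)) :=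
  Fintype.equivFin _

/-- Ranking boxes by level makes the inputs causal: those at level `k` involve only outputs from
lower levels. -/
theorem exists_alice_wiring (x : (Fin n → ZMod p) → ZMod p) (r s : BoxIndex p n → ZMod p) :
    ∃ w : Wiring (fun _ : Fin (Fintype.card (BoxIndex p n)) => ZMod p) (fun _ => ZMod p)
      Finset.univ, ∀ a j, w.input a j (Finset.mem_univ j) =
        r ((boxEquiv p n).symm j) + bareInput x r s (a ∘ boxEquiv p n) ((boxEquiv p n).symm j) := by
  obtain ⟨w, hw⟩ := Wiring.exists_input_eq
    (X := fun _ : Fin (Fintype.card (BoxIndex p n)) => ZMod p) (A := fun _ => ZMod p)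
    (fun j => ((boxEquiv p n).symm j).1.1)
    (fun j a => r ((boxEquiv p n).symm j) +
      bareInput x r s (a ∘ boxEquiv p n) ((boxEquiv p n).symm j))
    (fun j a a' h => by
      rw [bareInput_congr x (a' := a' ∘ boxEquiv p n) _ fun i hi => ⟨rfl, rfl, ?_⟩]
      exact h (boxEquiv p n i) (by rw [Equiv.symm_apply_apply]; exact hi))
    Finset.univ (fun _ => 0)
  exact ⟨w, fun a j => hw a (fun j hj => absurd (Finset.mem_univ j) hj) j _⟩

theorem exists_bob_wiring (z : Fin n → ZMod p) (s : BoxIndex p n → ZMod p) :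
    ∃ w : Wiring (fun _ : Fin (Fintype.card (BoxIndex p n)) => ZMod p) (fun _ => ZMod p)
      Finset.univ, ∀ b j, w.input b j (Finset.mem_univ j) =
        bobPower z ((boxEquiv p n).symm j) + s ((boxEquiv p n).symm j) := by
  obtain ⟨w, hw⟩ := Wiring.exists_input_eq
    (X := fun _ : Fin (Fintype.card (BoxIndex p n)) => ZMod p) (A := fun _ => ZMod p)
    (fun _ => 0)
    (fun j _ => bobPower z ((boxEquiv p n).symm j) + s ((boxEquiv p n).symm j))
    (fun _ _ _ _ => rfl) Finset.univ (fun _ => 0)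
  exact ⟨w, fun b j => hw b (fun j hj => absurd (Finset.mem_univ j) hj) j _⟩

/-- The nested random access code with shifted inputs; `E` identifies indices with addresses. -/
def nestedProtocol (hP : P.toResource ∈ W) (E : Fin N ≃ (Fin n → ZMod p)) : Protocol W p N 1 where
  Ω := (BoxIndex p n → ZMod p) × (BoxIndex p n → ZMod p)
  weight _ := (1 / (p : ℝ) ^ 2) ^ Fintype.card (BoxIndex p n)
  weight_nonneg _ := by positivity
  weight_sum := by
    have hp0 : (p : ℝ) ≠ 0 := Nat.cast_ne_zero.2 (NeZero.ne p)
    rw [Finset.sum_const, Finset.card_univ, Fintype.card_prod, Fintype.card_fun, ZMod.card,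
      nsmul_eq_mul, ← pow_two, Nat.cast_pow, Nat.cast_pow, pow_right_comm, ← mul_pow,
      mul_one_div_cancel (pow_ne_zero 2 hp0), one_pow]
  M := Fintype.card (BoxIndex p n)
  box _ := P.toResource
  box_mem _ := hP
  alice ω x := (exists_alice_wiring (x ∘ E.symm) ω.1 ω.2).choose
  message ω x a := fun _ => encode (x ∘ E.symm) ω.1 ω.2 (a ∘ boxEquiv p n) n 0
  bob ω y _ := (exists_bob_wiring (E y) ω.2).choose
  guess ω y μ b := bobGuess (E y) ω.1 (μ 0) (b ∘ boxEquiv p n)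

theorem nestedProtocol_outcomeProb (hP : P.toResource ∈ W) (E : Fin N ≃ (Fin n → ZMod p))
    (x : Fin N → ZMod p) (y : Fin N) (r s : BoxIndex p n → ZMod p)
    (a b : Fin (Fintype.card (BoxIndex p n)) → ZMod p) :
    (nestedProtocol hP E).outcomeProb (r, s) x y a b =
      ∏ j, P.prob (a (boxEquiv p n j)) (b (boxEquiv p n j))
        (r j + bareInput (x ∘ E.symm) r s (a ∘ boxEquiv p n) j) (bobPower (E y) j + s j) := by
  refine Fintype.prod_equiv (boxEquiv p n).symm _ _ fun j => ?_
  rw [Equiv.apply_symm_apply, ← (exists_alice_wiring (x ∘ E.symm) r s).choose_spec a j,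
    ← (exists_bob_wiring (E y) s).choose_spec b j]
  rfl

theorem nestedProtocol_guessProb (hP : P.toResource ∈ W) (E : Fin N ≃ (Fin n → ZMod p))
    (x : Fin N → ZMod p) (y : Fin N) (v : ZMod p) :
    (nestedProtocol hP E).guessProb x y v =
      sumProb P.runProb Run.error (path (E y)) (v - x y) := by
  -- The sum over independent runs is traded for one over shifts and outputs, to be matched term by
  -- term with the protocol.
  rw [sumProb, ← sum_twirl (fun j : BoxIndex p n => j.1.1)
    (fun r s a => bareInput (x ∘ E.symm) r s a)
    (fun r r' s a j h => bareInput_congr _ _ fun i hi => ⟨h i hi, rfl, rfl⟩) (bobPower (E y))]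
  refine Eq.trans (Fintype.sum_prod_type _) ?_
  refine Finset.sum_congr rfl fun r _ => Finset.sum_congr rfl fun s _ => ?_
  rw [Finset.mul_sum]
  refine Fintype.sum_equiv ((boxEquiv p n).symm.arrowCongr (Equiv.refl (ZMod p))) _ _ fun a => ?_
  rw [Finset.mul_sum]
  refine Fintype.sum_equiv ((boxEquiv p n).symm.arrowCongr (Equiv.refl (ZMod p))) _ _ fun b => ?_
  have hg : (nestedProtocol hP E).guess (r, s) y ((nestedProtocol hP E).message (r, s) x a) b =
      x y + ∑ j ∈ path (E y), Run.error
        ((r j + bareInput (x ∘ E.symm) r s (a ∘ boxEquiv p n) j, bobPower (E y) j + s j),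
          a (boxEquiv p n j), b (boxEquiv p n j)) := by
    have := bobGuess_encode (x ∘ E.symm) r s (a ∘ boxEquiv p n) (b ∘ boxEquiv p n) (E y)
    rw [Function.comp_apply, E.symm_apply_apply] at this
    exact this
  rw [hg, nestedProtocol_outcomeProb, mul_ite, mul_zero]
  refine if_congr eq_sub_iff_add_eq'.symm ?_ rfl
  -- The uniform weight of the shifts supplies the factor `1 / p ^ 2` of each run.
  simp only [PBox.runProb, Finset.prod_mul_distrib, Finset.prod_const, Finset.card_univ]
  rfl

theorem nestedProtocol_success (hP : P.toResource ∈ W) (E : Fin N ≃ (Fin n → ZMod p))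
    (q : ZMod p → ℝ) (hq : ∀ z : Fin n → ZMod p, sumProb P.runProb Run.error (path z) = q) :
    (nestedProtocol hP E).success = N * (Real.log p - ∑ c, Real.negMulLog (q c)) := by
  have hq1 : ∑ c, q c = 1 := by rw [← hq 0]; exact sum_sumProb _ _ _ P.sum_runProb
  have h : ∀ i, (nestedProtocol hP E).jointProb i = fun u v => (p : ℝ)⁻¹ * q (v - u) := by
    intro i
    funext u v
    rw [← sum_ite_apply_eq i u]
    refine Finset.sum_congr rfl fun x _ => ?_
    by_cases hx : x i = u
    · rw [if_pos hx, if_pos hx, nestedProtocol_guessProb, hq, hx]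
    · rw [if_neg hx, if_neg hx]
  simp only [Protocol.success, h, mutualInfo_noisy_copy q hq1]
  rw [Finset.sum_const, Finset.card_univ, Fintype.card_fin, nsmul_eq_mul]

end protocol

end

end InfoCausality

/-! ### The bound from information causality -/

theorem theorem3 (p : ℕ) [Fact p.Prime]
    (W : InfoCausality.World) (hW : InfoCausality.InformationCausality p W)
    (P : InfoCausality.PBox p) (hP : P.toResource ∈ W)
    (n : ℕ) (hn : 1 ≤ n) (N : ℕ) (hN : N = p ^ n) (c : ZMod p) :
    (InfoCausality.chi P (n * (p - 1)) c).im = 0 ∧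
    (InfoCausality.chi P (n * (p - 1)) c).re ≤
      InfoCausality.hpInv p (((N : ℝ) - 1) / N * Real.log p) := by
  open InfoCausality in
  have hp2 : 2 ≤ p := (Fact.out : p.Prime).two_le
  set q : ZMod p → ℝ := fun c => (chi P (n * (p - 1)) c).re with hq
  have hchi : ∀ (z : Fin n → ZMod p) c,
      chi P (n * (p - 1)) c = sumProb P.runProb Run.error (path z) c := fun z c => by
    -- All paths have `n * (p - 1)` boxes, so the error law is the same for every address.
    rw [← card_path z, chi_eq_sumProb]
  have hsum : ∀ z : Fin n → ZMod p, sumProb P.runProb Run.error (path z) = q := fun z =>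
    funext fun c => by simp only [hq, hchi z, Complex.ofReal_re]
  refine ⟨by rw [hchi 0, Complex.ofReal_im], ?_⟩
  have hq0 : ∀ c, 0 ≤ q c := fun c => by
    rw [← hsum 0]; exact sumProb_nonneg _ _ _ P.runProb_nonneg c
  have hq1 : ∑ c, q c = 1 := by rw [← hsum 0]; exact sum_sumProb _ _ _ P.sum_runProb
  have hqle : q c ≤ 1 := hq1 ▸ Finset.single_le_sum (fun d _ => hq0 d) (Finset.mem_univ c)
  have hcard : Fintype.card (Fin N) = Fintype.card (Fin n → ZMod p) := by
    rw [Fintype.card_fin, Fintype.card_fun, ZMod.card, Fintype.card_fin, hN]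
  have hN1 : (1 : ℝ) ≤ N := by
    rw [hN]; exact_mod_cast Nat.one_le_pow _ _ (by omega)
  have hlog : 0 ≤ Real.log p := Real.log_natCast_nonneg p
  have hIC := hW N 1 (nestedProtocol hP (Fintype.equivOfCardEq hcard))
  rw [nestedProtocol_success hP _ q hsum, Nat.cast_one, one_mul] at hIC
  have hfac : 0 ≤ ((N : ℝ) - 1) / N ∧ ((N : ℝ) - 1) / N ≤ 1 :=
    ⟨div_nonneg (by linarith) (by linarith), by rw [div_le_one (by linarith)]; linarith⟩
  -- What remains is that the entropy of `q` is at least `(N - 1) / N * log p`, a rearrangement of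
  -- `hIC`.
  refine le_hpInv hp2 (mul_nonneg hfac.1 hlog) (mul_le_of_le_one_left hlog hfac.2) hqle
    (le_trans ?_ (sum_negMulLog_le_hp hp2 q hq0 hq1 c))
  rw [div_mul_eq_mul_div, div_le_iff₀ (by linarith)]
  linarith
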